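/- Let $p,q,r$ be distinct positive integers, let $n=p+q+r$, and let $\alpha,\beta,\gamma,y_0,\dots,y_{n-1}$ be independent indeterminates. The recurrence $$y_{k+n}=\frac{\alpha\, y_{k+p}\,y_{k+n-p}+\beta\, y_{k+q}\,y_{k+n-q}+\gamma\, y_{k+r}\,y_{k+n-r}}{y_k}\qquad(k\ge 0)$$ defines a unique sequence $(y_m)_{m\ge 0}$ of rational functions (no term is zero, so the division is always possible), and every term $y_m$ is a Laurent polynomial in $y_0,\dots,y_{n-1}$ with coefficients in $\mathbb{Z}[\alpha,\beta,\gamma]$, that is, $y_m\in\mathbb{Z}[\alpha,\beta,\gamma][y_0^{\pm1},\dots,y_{n-1}^{\pm1}]$. In particular, the Gale–Robinson integrality conjecture holds: if instead $\alpha,\beta,\gamma$ are positive integers and $y_0=\dots=y_{n-1}=1$, then every term of the rational sequence defined by the recurrence is a (nonzero) integer. This covers the Somos-6 sequence ($y_0=\dots=y_5=1$, $y_{k+6}y_k=y_{k+1}y_{k+5}+y_{k+2}y_{k+4}+y_{k+3}^2$) and the Somos-7 sequence ($y_0=\dots=y_6=1$, $y_{k+7}y_k=y_{k+1}y_{k+6}+y_{k+2}y_{k+5}+y_{k+3}y_{k+4}$):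 all their terms are (nonzero) integers. -/

import Mathlib

/-- The coefficient ring `ℤ[α, β, γ]`: integer polynomials in three indeterminates. -/
abbrev GRCoeff : Type := MvPolynomial (Fin 3) ℤ

/-- The field of rational functions in the initial terms `y₀, …, y_{n-1}`, taken as independent
variables over `ℤ[α, β, γ]`. -/
abbrev GRField (n : ℕ) : Type := FractionRing (MvPolynomial (Fin n) GRCoeff)

/-- A coefficient indeterminate, as a rational function: the indices `0, 1, 2` stand for
`α, β, γ`. -/
noncomputable def GRField.param (n : ℕ) (j : Fin 3) : GRField n :=
  algebraMap GRCoeff (GRField n) (MvPolynomial.X j)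

/-- The `i`-th initial variable, as a rational function. -/
noncomputable def GRField.var (n : ℕ) (i : Fin n) : GRField n :=
  algebraMap (MvPolynomial (Fin n) GRCoeff) (GRField n) (MvPolynomial.X i)

/-- The ring `ℤ[α, β, γ][y₀^{±1}, …, y_{n-1}^{±1}]` of Laurent polynomials in the initial
variables with coefficients in `ℤ[α, β, γ]`, inside the field of rational functions. -/
noncomputable def laurentRing (n : ℕ) : Subalgebra GRCoeff (GRField n) :=
  Algebra.adjoin GRCoeff
    (Set.range (GRField.var n) ∪ Set.range fun i => (GRField.var n i)⁻¹)

/-- The three-term Gale-Robinson recurrence with `n = p + q + r`. -/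
def IsGaleRobinson {F : Type*} [Field F] (p q r : ℕ) (α β γ : F) (y : ℕ → F) : Prop :=
  ∀ k : ℕ, y (k + (p + q + r)) =
    (α * y (k + p) * y (k + (p + q + r) - p)
      + β * y (k + q) * y (k + (p + q + r) - q)
      + γ * y (k + r) * y (k + (p + q + r) - r)) / y k

/-- `y` is the generic Gale-Robinson sequence: it satisfies the recurrence with indeterminate
coefficients `α, β, γ`, and its first `n` terms are the independent variables. -/
def IsGenericGaleRobinson (p q r : ℕ) (y : ℕ → GRField (p + q + r)) : Prop :=
  (∀ i : Fin (p + q + r), y i = GRField.var (p + q + r) i) ∧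
    IsGaleRobinson p q r (GRField.param (p + q + r) 0) (GRField.param (p + q + r) 1)
      (GRField.param (p + q + r) 2) y

/-! Placing `y` at index `M + (p * i + q * j + r * k)` on the point `(i, j, k)` of `ℤ³` turns the
Gale-Robinson recurrence into the cube recurrence, because `n - p = q + r` and likewise for `q` and
`r`. It therefore suffices to show that a term of the cube recurrence is a Laurent polynomial in the
terms of any window of `n` consecutive levels below it (`CubeRec.mem_windowRing`).

The proof is by induction on the distance `T - m` from the bottom `m` of the window to the top level
`T`. For `T < m + 2 * n` the recurrence divides by a term of the window. For `T = m + 2 * n` that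
divisor lies just above the window, but `CubeRec.block` avoids it and divides by three terms of the
window instead.

For larger `T` the solution is first taken generic, with independent variables in the window. By
induction, a term at level `T` is Laurent in the windows starting at `m + 1` and at `m + n + 1`.
Over the Laurent ring of the window at `m`, the first expression has only exchange polynomials of
cubes based at level `m` as denominators, and the second only terms of levels `m + n + 1` to `m + 2
* n`. The exchange polynomials are prime (`prime_exchange`) and divide none of those terms
(`exchange_not_dvd`), so no denominator remains. The resulting formula specializes to every
nonvanishing solution.

Terms never vanish, since the recurrence is subtraction-free and its terms are positive when all
indeterminates are `1`. -/

/-! ### The cube recurrence -/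

/-- `Y` satisfies the cube recurrence on all unit cubes of `ℤ³` whose lowest vertex has level at
least `m` and whose highest vertex has level at most `T`, where `(i, j, k)` has level
`p * i + q * j + r * k`. -/
def CubeRec (p q r m T : ℤ) {K : Type*} [CommRing K] (α β γ : K) (Y : ℤ → ℤ → ℤ → K) : Prop :=
  ∀ i j k : ℤ, m ≤ p * i + q * j + r * k → p * i + q * j + r * k + (p + q + r) ≤ T →
    Y (i + 1) (j + 1) (k + 1) * Y i j k =
      α * Y i (j + 1) (k + 1) * Y (i + 1) j k + β * Y (i + 1) j (k + 1) * Y i (j + 1) k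
        + γ * Y (i + 1) (j + 1) k * Y i j (k + 1)

theorem CubeRec.mono {p q r m T m' T' : ℤ} {K : Type*} [CommRing K] {α β γ : K}
    {Y : ℤ → ℤ → ℤ → K} (h : CubeRec p q r m T α β γ Y) (hm : m ≤ m') (hT : T' ≤ T) :
    CubeRec p q r m' T' α β γ Y :=
  fun i j k h1 h2 => h i j k (hm.trans h1) (h2.trans hT)

theorem CubeRec.map {p q r m T : ℤ} {K S : Type*} [CommRing K] [CommRing S] {α β γ : K}
    {Y : ℤ → ℤ → ℤ → K} (h : CubeRec p q r m T α β γ Y) (φ : K →+* S) :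
    CubeRec p q r m T (φ α) (φ β) (φ γ) (fun i j k => φ (Y i j k)) := by
  intro i j k h1 h2
  have := congrArg φ (h i j k h1 h2)
  simpa only [map_mul, map_add] using this

/-- Eliminating the centre of a block of eight unit cubes. -/
theorem CubeRec.block {p q r m T : ℤ} (hp : 0 < p) (hq : 0 < q) (hr : 0 < r)
    {K : Type*} [CommRing K] [IsDomain K] {α β γ : K}
    {Y : ℤ → ℤ → ℤ → K} (h : CubeRec p q r m T α β γ Y) (i j k : ℤ)
    (h1 : m ≤ p * i + q * j + r * k) (h2 : p * i + q * j + r * k + 2 * (p + q + r) ≤ T)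
    (h0 : Y (i + 1) (j + 1) (k + 1) ≠ 0) :
    Y i (j + 1) (k + 1) * Y (i + 1) j (k + 1) * Y (i + 1) (j + 1) k * Y (i + 2) (j + 2) (k + 2) =
      Y (i + 2) (j + 1) (k + 1) * Y (i + 1) (j + 2) (k + 1) * Y (i + 1) (j + 1) (k + 2) * Y i j k
      + α ^ 2 * Y (i + 1) j (k + 1) * Y (i + 1) (j + 1) k * Y (i + 2) (j + 1) (k + 1)
          * Y i (j + 2) (k + 2)
      + β ^ 2 * Y i (j + 1) (k + 1) * Y (i + 1) (j + 1) k * Y (i + 1) (j + 2) (k + 1)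
          * Y (i + 2) j (k + 2)
      + γ ^ 2 * Y i (j + 1) (k + 1) * Y (i + 1) j (k + 1) * Y (i + 1) (j + 1) (k + 2)
          * Y (i + 2) (j + 2) k
      - α ^ 2 * Y i (j + 1) (k + 1) * Y (i + 2) j k * Y (i + 1) (j + 2) (k + 1)
          * Y (i + 1) (j + 1) (k + 2)
      - β ^ 2 * Y (i + 1) j (k + 1) * Y i (j + 2) k * Y (i + 2) (j + 1) (k + 1)
          * Y (i + 1) (j + 1) (k + 2)
      - γ ^ 2 * Y (i + 1) (j + 1) k * Y i j (k + 2) * Y (i + 2) (j + 1) (k + 1)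
          * Y (i + 1) (j + 2) (k + 1) := by
  have e0 := h i j k (by linarith) (by linarith)
  have e7 := h (i + 1) (j + 1) (k + 1) (by linarith) (by linarith)
  have ea := h i (j + 1) (k + 1) (by linarith) (by linarith)
  have eb := h (i + 1) j (k + 1) (by linarith) (by linarith)
  have ec := h (i + 1) (j + 1) k (by linarith) (by linarith)
  have eA := h (i + 1) j k (by linarith) (by linarith)
  have eB := h i (j + 1) k (by linarith) (by linarith)
  have eC := h i j (k + 1) (by linarith) (by linarith)
  simp only [add_assoc, one_add_one_eq_two] at e7 ea eb ec eA eB eC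
  apply mul_right_cancel₀ h0
  generalize Y (i + 1) (j + 1) (k + 1) = h0' at *
  generalize Y i (j + 1) (k + 1) = a at *
  generalize Y (i + 1) j (k + 1) = b at *
  generalize Y (i + 1) (j + 1) k = c at *
  generalize Y (i + 1) j k = A at *
  generalize Y i (j + 1) k = B at *
  generalize Y i j (k + 1) = C at *
  generalize Y (i + 2) (j + 1) (k + 1) = yp at *
  generalize Y (i + 1) (j + 2) (k + 1) = yq at *
  generalize Y (i + 1) (j + 1) (k + 2) = yr at *
  linear_combination a * b * c * e7 + α * yp * b * c * ea + β * yq * a * c * eb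
    + γ * yr * a * b * ec - yp * yq * yr * e0 - α * a * yq * yr * eA - β * b * yp * yr * eB
    - γ * c * yp * yq * eC

/-- A strong induction principle on the level of a lattice point. -/
theorem level_induction {p q r m : ℤ} {C : ℤ → ℤ → ℤ → Prop}
    (step : ∀ i j k, m ≤ p * i + q * j + r * k →
      (∀ i' j' k', m ≤ p * i' + q * j' + r * k' →
        p * i' + q * j' + r * k' < p * i + q * j + r * k → C i' j' k') → C i j k)
    (i j k : ℤ) (h : m ≤ p * i + q * j + r * k) : C i j k := by
  suffices H : ∀ N : ℕ, ∀ i j k, m ≤ p * i + q * j + r * k →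
      (p * i + q * j + r * k - m).toNat = N → C i j k from H _ i j k h rfl
  intro N
  induction N using Nat.strong_induction_on with
  | _ N ih =>
    intro i j k h hN
    refine step i j k h fun i' j' k' h' hlt => ih _ ?_ i' j' k' h' rfl
    omega

/-- Induction along the cube recurrence: initial points, then the last vertex of a cube. -/
theorem cube_induction {p q r m T : ℤ} (hp : 0 < p) (hq : 0 < q) (hr : 0 < r)
    {C : ℤ → ℤ → ℤ → Prop}
    (init : ∀ i j k, m ≤ p * i + q * j + r * k → p * i + q * j + r * k < m + (p + q + r) →
      C i j k)
    (step : ∀ i j k, m ≤ p * i + q * j + r * k → p * i + q * j + r * k + (p + q + r) ≤ T →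
      C i j k → C i (j + 1) (k + 1) → C (i + 1) j k → C (i + 1) j (k + 1) → C i (j + 1) k →
      C (i + 1) (j + 1) k → C i j (k + 1) → C (i + 1) (j + 1) (k + 1))
    (i j k : ℤ) (h : m ≤ p * i + q * j + r * k) (hT : p * i + q * j + r * k ≤ T) : C i j k := by
  revert hT
  refine level_induction (p := p) (q := q) (r := r) (m := m)
    (C := fun i j k => p * i + q * j + r * k ≤ T → C i j k) ?_ i j k h
  intro i j k h ih hT
  by_cases hlt : p * i + q * j + r * k < m + (p + q + r)
  · exact init i j k h hlt
  · have := step (i - 1) (j - 1) (k - 1) (by linarith) (by linarith)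
    simp only [sub_add_cancel] at this
    apply this <;> apply ih <;> linarith

/-- A nonvanishing solution of the cube recurrence is determined by its initial values. -/
theorem CubeRec.ext {p q r m T : ℤ} (hp : 0 < p) (hq : 0 < q) (hr : 0 < r)
    {K : Type*} [CommRing K] [IsDomain K] {α β γ : K} {Y Z : ℤ → ℤ → ℤ → K}
    (hY : CubeRec p q r m T α β γ Y) (hZ : CubeRec p q r m T α β γ Z)
    (h0 : ∀ i j k, Y i j k ≠ 0)
    (init : ∀ i j k, m ≤ p * i + q * j + r * k → p * i + q * j + r * k < m + (p + q + r) →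
      Z i j k = Y i j k)
    (i j k : ℤ) (h : m ≤ p * i + q * j + r * k) (hT : p * i + q * j + r * k ≤ T) :
    Z i j k = Y i j k := by
  refine cube_induction (C := fun i j k => Z i j k = Y i j k) hp hq hr init ?_ i j k h hT
  intro i j k h1 h2 a b c d e f g
  have hy := hY i j k h1 h2
  have hz := hZ i j k h1 h2
  rw [a, b, c, d, e, f, g, ← hy] at hz
  exact mul_right_cancel₀ (h0 i j k) hz

/-- The solution of the cube recurrence with initial values `f` at the levels below
`m + (p + q + r)`. -/
noncomputable def cubeSol {p q r : ℤ} (m : ℤ) (hp : 0 < p) (hq : 0 < q) (hr : 0 < r) {K : Type*}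
    [Field K] (α β γ : K) (f : ℤ → ℤ → ℤ → K) (i j k : ℤ) : K :=
  if p * i + q * j + r * k < m + (p + q + r) then f i j k else
    (α * cubeSol m hp hq hr α β γ f (i - 1) j k * cubeSol m hp hq hr α β γ f i (j - 1) (k - 1)
      + β * cubeSol m hp hq hr α β γ f i (j - 1) k * cubeSol m hp hq hr α β γ f (i - 1) j (k - 1)
      + γ * cubeSol m hp hq hr α β γ f i j (k - 1) * cubeSol m hp hq hr α β γ f (i - 1) (j - 1) k)
      / cubeSol m hp hq hr α β γ f (i - 1) (j - 1) (k - 1)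
termination_by (p * i + q * j + r * k - m).toNat
decreasing_by
  all_goals
    rw [Int.toNat_lt_toNat] <;> linarith

section
variable {p q r : ℤ} (m : ℤ) (hp : 0 < p) (hq : 0 < q) (hr : 0 < r) {K : Type*}
    [Field K] (α β γ : K) (f : ℤ → ℤ → ℤ → K)

theorem cubeSol_init (i j k : ℤ) (h : p * i + q * j + r * k < m + (p + q + r)) :
    cubeSol m hp hq hr α β γ f i j k = f i j k := by
  rw [cubeSol, if_pos h]

theorem cubeSol_step (i j k : ℤ) (h : m ≤ p * i + q * j + r * k) :
    cubeSol m hp hq hr α β γ f (i + 1) (j + 1) (k + 1) =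
      (α * cubeSol m hp hq hr α β γ f i (j + 1) (k + 1) * cubeSol m hp hq hr α β γ f (i + 1) j k
      + β * cubeSol m hp hq hr α β γ f (i + 1) j (k + 1) * cubeSol m hp hq hr α β γ f i (j + 1) k
      + γ * cubeSol m hp hq hr α β γ f (i + 1) (j + 1) k * cubeSol m hp hq hr α β γ f i j (k + 1))
      / cubeSol m hp hq hr α β γ f i j k := by
  rw [cubeSol, if_neg (by linarith)]
  simp only [add_sub_cancel_right]

theorem cubeSol_mem {C : K → Prop} (hadd : ∀ x y, C x → C y → C (x + y))
    (hmul : ∀ x y, C x → C y → C (x * y)) (hdiv : ∀ x y, C x → C y → C (x / y))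
    (hα : C α) (hβ : C β) (hγ : C γ) (hf : ∀ i j k, C (f i j k)) (i j k : ℤ) :
    C (cubeSol m hp hq hr α β γ f i j k) := by
  rcases lt_or_ge (p * i + q * j + r * k) m with h | h
  · rw [cubeSol_init _ _ _ _ _ _ _ _ _ _ _ (by linarith)]
    exact hf i j k
  refine cube_induction (m := m) (T := p * i + q * j + r * k)
    (C := fun i j k => C (cubeSol m hp hq hr α β γ f i j k)) hp hq hr ?_ ?_ i j k h le_rfl
  · intro i j k _ h
    rw [cubeSol_init _ _ _ _ _ _ _ _ _ _ _ h]
    exact hf i j k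
  · intro i j k h _ h1 h2 h3 h4 h5 h6 h7
    rw [cubeSol_step _ _ _ _ _ _ _ _ _ _ _ h]
    exact hdiv _ _ (hadd _ _ (hadd _ _ (hmul _ _ (hmul _ _ hα h2) h3)
      (hmul _ _ (hmul _ _ hβ h4) h5)) (hmul _ _ (hmul _ _ hγ h6) h7)) h1

theorem cubeSol_cubeRec (h0 : ∀ i j k, cubeSol m hp hq hr α β γ f i j k ≠ 0) (T : ℤ) :
    CubeRec p q r m T α β γ (cubeSol m hp hq hr α β γ f) := by
  intro i j k h _
  rw [cubeSol_step _ _ _ _ _ _ _ _ _ _ _ h, div_mul_cancel₀ _ (h0 i j k)]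

end

/-! ### Fractions that are positive under a specialization -/

/-- `z` is a quotient of two elements of `A` that are positive under `ε`. -/
def IsPosFrac {A K : Type*} [CommRing A] [Field K] [Algebra A K] (ε : A →+* ℚ) (z : K) : Prop :=
  ∃ f g : A, 0 < ε f ∧ 0 < ε g ∧ z = algebraMap A K f / algebraMap A K g

section
variable {A K : Type*} [CommRing A] [Field K] [Algebra A K] {ε : A →+* ℚ}

theorem IsPosFrac.of_pos {f : A} (h : 0 < ε f) : IsPosFrac ε (algebraMap A K f) :=
  ⟨f, 1, h, by simp, by simp⟩

theorem IsPosFrac.mul {x y : K} (hx : IsPosFrac ε x) (hy : IsPosFrac ε y) :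
    IsPosFrac ε (x * y) := by
  obtain ⟨f, g, hf, hg, rfl⟩ := hx
  obtain ⟨f', g', hf', hg', rfl⟩ := hy
  exact ⟨f * f', g * g', by rw [map_mul]; positivity, by rw [map_mul]; positivity,
    by rw [map_mul, map_mul, div_mul_div_comm]⟩

theorem IsPosFrac.div {x y : K} (hx : IsPosFrac ε x) (hy : IsPosFrac ε y) :
    IsPosFrac ε (x / y) := by
  obtain ⟨f, g, hf, hg, rfl⟩ := hx
  obtain ⟨f', g', hf', hg', rfl⟩ := hy
  exact ⟨f * g', g * f', by rw [map_mul]; positivity, by rw [map_mul]; positivity,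
    by rw [map_mul, map_mul, div_div_div_eq]⟩

theorem IsPosFrac.ne_zero_of_pos [FaithfulSMul A K] {g : A} (hg : 0 < ε g) :
    algebraMap A K g ≠ 0 := by
  intro h
  rw [(FaithfulSMul.algebraMap_injective A K).eq_iff' (map_zero _)] at h
  simp [h] at hg

/-- Together with closure under sum, product and quotient, this gives the nonvanishing of everything
produced by a subtraction-free recurrence. -/
theorem IsPosFrac.ne_zero [FaithfulSMul A K] {x : K} (hx : IsPosFrac ε x) : x ≠ 0 := by
  obtain ⟨f, g, hf, hg, rfl⟩ := hx
  exact div_ne_zero (ne_zero_of_pos hf) (ne_zero_of_pos hg)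

theorem IsPosFrac.add [FaithfulSMul A K] {x y : K} (hx : IsPosFrac ε x) (hy : IsPosFrac ε y) :
    IsPosFrac ε (x + y) := by
  obtain ⟨f, g, hf, hg, rfl⟩ := hx
  obtain ⟨f', g', hf', hg', rfl⟩ := hy
  refine ⟨f * g' + g * f', g * g', ?_, ?_, ?_⟩
  · rw [map_add, map_mul, map_mul]; positivity
  · rw [map_mul]; positivity
  · rw [div_add_div _ _ (ne_zero_of_pos hg) (ne_zero_of_pos hg')]
    simp only [map_add, map_mul]

end

/-! ### Laurent polynomials in variables indexed by the cubic lattice -/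

/-- The submonoid of monomials in the lattice variables of `ℤ[α, β, γ][Y_x : x ∈ ℤ³]`. -/
noncomputable def latticeMonomials : Submonoid (MvPolynomial (Fin 3 ⊕ ℤ × ℤ × ℤ) ℤ) :=
  Submonoid.closure (Set.range fun x => MvPolynomial.X (Sum.inr x))

/-- The Laurent polynomial ring `ℤ[α, β, γ][Y_x^{±1} : x ∈ ℤ³]`. -/
abbrev LatticeLaurent : Type := Localization latticeMonomials

namespace LatticeLaurent

/-- The coefficient indeterminates. -/
noncomputable def param (t : Fin 3) : LatticeLaurent :=
  algebraMap (MvPolynomial (Fin 3 ⊕ ℤ × ℤ × ℤ) ℤ) _ (MvPolynomial.X (Sum.inl t))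

/-- The lattice variables. -/
noncomputable def var (x : ℤ × ℤ × ℤ) : LatticeLaurentˣ :=
  (IsLocalization.map_units LatticeLaurent (M := latticeMonomials)
    ⟨MvPolynomial.X (Sum.inr x), Submonoid.subset_closure ⟨x, rfl⟩⟩).unit

theorem val_var (x : ℤ × ℤ × ℤ) : (var x : LatticeLaurent) =
    algebraMap (MvPolynomial (Fin 3 ⊕ ℤ × ℤ × ℤ) ℤ) _ (MvPolynomial.X (Sum.inr x)) := rfl

instance : IsDomain LatticeLaurent := by
  refine IsLocalization.isDomain_localization (le_nonZeroDivisors_of_noZeroDivisors fun h => ?_)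
  have : latticeMonomials ≤
      (nonZeroDivisors (MvPolynomial (Fin 3 ⊕ ℤ × ℤ × ℤ) ℤ)) := by
    rw [latticeMonomials, Submonoid.closure_le]
    rintro _ ⟨x, rfl⟩
    exact mem_nonZeroDivisors_of_ne_zero (MvPolynomial.X_ne_zero _)
  exact zero_notMem_nonZeroDivisors (this h)

theorem hom_ext {S : Type*} [CommRing S] {φ ψ : LatticeLaurent →+* S}
    (hc : ∀ t, φ (param t) = ψ (param t)) (hv : ∀ x, φ (var x) = ψ (var x)) : φ = ψ := by
  refine IsLocalization.ringHom_ext latticeMonomials (MvPolynomial.ringHom_ext ?_ ?_)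
  · intro n
    simp
  · rintro (t | x)
    · exact hc t
    · exact hv x

/-- The ring homomorphism with prescribed values at the indeterminates. -/
noncomputable def lift {S : Type*} [CommRing S] (c : Fin 3 → S) (f : ℤ × ℤ × ℤ → Sˣ) :
    LatticeLaurent →+* S :=
  IsLocalization.lift (M := latticeMonomials)
    (g := MvPolynomial.eval₂Hom (Int.castRingHom S) (Sum.elim c fun x => (f x : S))) <| by
      rintro ⟨y, hy⟩
      refine Submonoid.closure_induction
        (motive := fun y _ => IsUnit (MvPolynomial.eval₂Hom (Int.castRingHom S)
          (Sum.elim c fun x => (f x : S)) y)) ?_ ?_ ?_ hy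
      · rintro _ ⟨x, rfl⟩
        simp
      · simp
      · intro a b _ _ ha hb
        rw [map_mul]
        exact ha.mul hb

section
variable {S : Type*} [CommRing S] (c : Fin 3 → S) (f : ℤ × ℤ × ℤ → Sˣ)

@[simp]
theorem lift_param (t : Fin 3) : lift c f (param t) = c t := by
  simp [lift, param]

@[simp]
theorem lift_var (x : ℤ × ℤ × ℤ) : lift c f (var x) = f x := by
  simp [lift, val_var]

end

theorem lift_mem {K : Type*} [Field K] (R : Subring K) (c : Fin 3 → K) (f : ℤ × ℤ × ℤ → Kˣ)
    (hc : ∀ t, c t ∈ R) (hf : ∀ x, (f x : K) ∈ R) (hf' : ∀ x, (f x : K)⁻¹ ∈ R)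
    (z : LatticeLaurent) : lift c f z ∈ R := by
  let g : ℤ × ℤ × ℤ → Rˣ := fun x =>
    ⟨⟨f x, hf x⟩, ⟨(f x : K)⁻¹, hf' x⟩, by ext; simp, by ext; simp⟩
  have : lift c f = R.subtype.comp (lift (fun t => ⟨c t, hc t⟩) g) := by
    apply hom_ext <;> intro x <;> simp [g]
  rw [this]
  exact (lift (fun t => (⟨c t, hc t⟩ : R)) g z).2

/-- The homomorphism sending all indeterminates to `1`. -/
noncomputable def one : LatticeLaurent →+* ℚ := lift (fun _ => 1) (fun _ => 1)

theorem two_ne_zero : (2 : LatticeLaurent) ≠ 0 := fun h => by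
  have := congrArg one h
  rw [map_ofNat, map_zero] at this
  norm_num at this

/-- The numerator of the exchange relation of the cube with lowest vertex `(i, j, k)`. -/
noncomputable def exchange (i j k : ℤ) : LatticeLaurent :=
  param 0 * var (i, j + 1, k + 1) * var (i + 1, j, k)
    + param 1 * var (i + 1, j, k + 1) * var (i, j + 1, k)
    + param 2 * var (i + 1, j + 1, k) * var (i, j, k + 1)

/-- The value of `α` at which the exchange polynomial vanishes. -/
noncomputable def root (i j k : ℤ) : LatticeLaurent :=
  -(param 1 * var (i + 1, j, k + 1) * var (i, j + 1, k)
    + param 2 * var (i + 1, j + 1, k) * var (i, j, k + 1))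
    * ↑(var (i, j + 1, k + 1) * var (i + 1, j, k))⁻¹

/-- The endomorphism solving the exchange relation for `α`. -/
noncomputable def solve (i j k : ℤ) : LatticeLaurent →+* LatticeLaurent :=
  lift ![root i j k, param 1, param 2] var

theorem exchange_eq (i j k : ℤ) : exchange i j k =
    (param 0 - root i j k) * ↑(var (i, j + 1, k + 1) * var (i + 1, j, k)) := by
  rw [sub_mul, root, Units.inv_mul_cancel_right, exchange]
  push_cast
  ring

theorem solve_exchange (i j k : ℤ) : solve i j k (exchange i j k) = 0 := by
  have h : exchange i j k = param 0 * ↑(var (i, j + 1, k + 1) * var (i + 1, j, k))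
    + (param 1 * var (i + 1, j, k + 1) * var (i, j + 1, k)
    + param 2 * var (i + 1, j + 1, k) * var (i, j, k + 1)) := by
    rw [exchange]; push_cast; ring
  rw [h]
  simp only [map_add, map_mul, solve, lift_param, lift_var, Units.val_mul, Matrix.cons_val]
  rw [← Units.val_mul, root, Units.inv_mul_cancel_right]
  ring

/-- Modulo the exchange polynomial, `α` is congruent to `root i j k`, so `solve i j k` induces the
identity on the quotient and its kernel is exactly the principal ideal. -/
theorem exchange_dvd_iff (i j k : ℤ) (z : LatticeLaurent) :
    exchange i j k ∣ z ↔ solve i j k z = 0 := by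
  constructor
  · rintro ⟨w, rfl⟩
    rw [map_mul, solve_exchange, zero_mul]
  · intro h
    have key : (Ideal.Quotient.mk (Ideal.span {exchange i j k})).comp (solve i j k) =
        Ideal.Quotient.mk (Ideal.span {exchange i j k}) := by
      refine hom_ext (S := LatticeLaurent ⧸ Ideal.span {exchange i j k}) ?_ ?_
      · intro t
        rw [RingHom.comp_apply, solve, lift_param]
        fin_cases t
        · refine (Ideal.Quotient.eq.mpr ?_).symm
          rw [Ideal.mem_span_singleton, exchange_eq, Units.mul_right_dvd]
          exact dvd_rfl
        · rfl
        · rfl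
      · intro x
        rw [RingHom.comp_apply, solve, lift_var]
    have := RingHom.congr_fun key z
    rw [RingHom.comp_apply, h, map_zero] at this
    exact Ideal.mem_span_singleton.mp (Ideal.Quotient.eq_zero_iff_mem.mp this.symm)

/-- The exchange polynomial generates the kernel of `solve i j k`, an endomorphism of a domain. It
is nonzero because it takes the value `3` when all indeterminates are `1`. -/
theorem prime_exchange (i j k : ℤ) : Prime (exchange i j k) := by
  refine ⟨fun h => ?_, fun h => ?_, fun a b h => ?_⟩
  · have := congrArg one h
    norm_num [one, exchange] at this
  · have := h.map (solve i j k)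
    rw [solve_exchange] at this
    exact not_isUnit_zero this
  · simpa only [exchange_dvd_iff, map_mul, mul_eq_zero] using h

end LatticeLaurent

/-! ### Coprimality of nearby terms of the cube recurrence -/

theorem CubeRec.swap_fst_snd {p q r m T : ℤ} {K : Type*} [CommRing K] {α β γ : K}
    {Y : ℤ → ℤ → ℤ → K} (h : CubeRec p q r m T α β γ Y) :
    CubeRec q p r m T β α γ (fun i j k => Y j i k) := by
  intro i j k h1 h2
  have := h j i k (by linarith) (by linarith)
  linear_combination this

theorem CubeRec.swap_fst_trd {p q r m T : ℤ} {K : Type*} [CommRing K] {α β γ : K}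
    {Y : ℤ → ℤ → ℤ → K} (h : CubeRec p q r m T α β γ Y) :
    CubeRec r q p m T γ β α (fun i j k => Y k j i) := by
  intro i j k h1 h2
  have := h k j i (by linarith) (by linarith)
  linear_combination this

/-- Initial values which are `1` off the plane `i = a + 1`, and for which the term at
`(a + 1, b + 1, c + 1)` vanishes when `α = 0` and `β = γ = 1 / 2`. -/
def planeWeight (a b c i j k : ℤ) : ℚ :=
  if i = a + 1 then
    if j = b ∧ k = c + 1 then 1 else if j = b + 1 ∧ k = c then -1 else 3
  else 1

theorem planeWeight_ne_zero (a b c i j k : ℤ) : planeWeight a b c i j k ≠ 0 := by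
  unfold planeWeight
  split_ifs <;> norm_num

/-- With `α = 0` the terms with `i ≤ a` all equal `1`, so on the plane `i = a + 1` each new term is
the average of two earlier ones. The values `1` and `-1` average to `0` at `(b + 1, c + 1)`. The
background value `3` outweighs the `-1` in the only other average that can involve it, and the zero
is only averaged with positive terms. -/
theorem planeWeight_term_ne_zero {p q r m T : ℤ} (hp : 0 < p) (hq : 0 < q) (hr : 0 < r)
    {Y : ℤ → ℤ → ℤ → ℚ} (h : CubeRec p q r m T 0 (1 / 2) (1 / 2) Y) {a b c : ℤ}
    (hm : p * a + q * b + r * c = m)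
    (init : ∀ i j k, m ≤ p * i + q * j + r * k → p * i + q * j + r * k < m + (p + q + r) →
      Y i j k = planeWeight a b c i j k)
    {i j k : ℤ} (h1 : m ≤ p * i + q * j + r * k) (h2 : p * i + q * j + r * k ≤ T)
    (hi : i ≤ a + 1) (hne : ¬(i = a + 1 ∧ j = b + 1 ∧ k = c + 1)) : Y i j k ≠ 0 := by
  have below : ∀ i j k, m ≤ p * i + q * j + r * k → p * i + q * j + r * k ≤ T →
      i ≤ a → Y i j k = 1 := by
    refine cube_induction (C := fun i j k => i ≤ a → Y i j k = 1) hp hq hr ?_ ?_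
    · intro i j k h1 h2 hi
      rw [init i j k h1 h2, planeWeight, if_neg (by omega)]
    · intro i j k h1 h2 e0 e1 e2 e3 e4 e5 e6 hi
      have := h i j k h1 h2
      rw [e0 (by omega), e1 (by omega), e2 (by omega), e3 (by omega), e4 (by omega),
        e5 (by omega), e6 (by omega)] at this
      linarith
  have avg : ∀ i j k, m ≤ p * i + q * j + r * k → p * i + q * j + r * k + (p + q + r) ≤ T →
      i = a → Y (i + 1) (j + 1) (k + 1) = (Y (i + 1) j (k + 1) + Y (i + 1) (j + 1) k) / 2 := by
    intro i j k h1 h2 hi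
    have := h i j k h1 h2
    rw [below i j k h1 (by linarith) hi.le, below i (j + 1) k (by linarith) (by linarith) hi.le,
      below i j (k + 1) (by linarith) (by linarith) hi.le] at this
    linarith
  -- The bound `3` is what compensates the `-1` at `(b + 1, c)` in the average giving the term at
  -- `(b + 2, c)`.
  have far : ∀ i j k, m ≤ p * i + q * j + r * k → p * i + q * j + r * k ≤ T →
      i = a + 1 → j < b ∨ k < c → 3 ≤ Y i j k := by
    refine cube_induction (C := fun i j k => i = a + 1 → j < b ∨ k < c → 3 ≤ Y i j k)
      hp hq hr ?_ ?_
    · intro i j k h1 h2 hi hjk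
      rw [init i j k h1 h2, planeWeight, if_pos hi, if_neg (by omega), if_neg (by omega)]
    · intro i j k h1 h2 _ _ _ e3 _ e5 _ hi hjk
      rw [avg i j k h1 h2 (by omega)]
      have := e3 hi (by omega)
      have := e5 hi (by omega)
      linarith
  have pos : ∀ i j k, m ≤ p * i + q * j + r * k → p * i + q * j + r * k ≤ T →
      i = a + 1 → ¬(j = b + 1 ∧ k = c + 1) → ¬(j = b + 1 ∧ k = c) → 0 < Y i j k := by
    refine cube_induction (C := fun i j k => i = a + 1 → ¬(j = b + 1 ∧ k = c + 1) →
      ¬(j = b + 1 ∧ k = c) → 0 < Y i j k) hp hq hr ?_ ?_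
    · intro i j k h1 h2 hi hv hc
      rw [init i j k h1 h2, planeWeight, if_pos hi, if_neg hc]
      split_ifs <;> norm_num
    · intro i j k h1 h2 _ _ _ e3 _ e5 _ hi hv hc
      obtain rfl : i = a := by omega
      have h0 : ∀ j k, j = b → k = c → Y (i + 1) (j + 1) (k + 1) = 0 := by
        rintro j k rfl rfl
        rw [avg i j k (by linarith) (by linarith) rfl, init _ _ _ (by linarith) (by linarith),
          init _ _ _ (by linarith) (by linarith)]
        simp [planeWeight]
      rw [avg i j k h1 h2 rfl]
      by_cases c1 : j = b + 1 ∧ k = c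
      · obtain ⟨rfl, rfl⟩ := c1
        rw [h0 b k rfl rfl]
        have := e5 rfl (by omega) (by omega)
        linarith
      by_cases c2 : j = b + 1 ∧ k + 1 = c
      · obtain ⟨rfl, rfl⟩ := c2
        have := far (i + 1) (b + 1 + 1) k (by linarith) (by linarith) rfl (by omega)
        have : Y (i + 1) (b + 1) (k + 1) = -1 := by
          rw [init _ _ _ (by linarith) (by linarith)]
          simp [planeWeight]
        linarith
      have := e3 rfl (by omega) (by omega)
      by_cases c3 : j = b ∧ k = c + 1
      · obtain ⟨rfl, rfl⟩ := c3
        rw [h0 j c rfl rfl]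
        linarith
      have := e5 rfl (by omega) (by omega)
      linarith
  rcases hi.lt_or_eq with hi | hi
  · rw [below i j k h1 h2 (by omega)]
    norm_num
  · by_cases hc : j = b + 1 ∧ k = c
    · obtain ⟨rfl, rfl⟩ := hc
      subst hi
      rw [init _ _ _ h1 (by linarith)]
      exact planeWeight_ne_zero _ _ _ _ _ _
    · exact (pos i j k h1 h2 hi (by tauto) hc).ne'

/-! ### Divisibility of terms by an exchange polynomial. -/

namespace LatticeLaurent

section
variable {p q r m T : ℤ} {Y : ℤ → ℤ → ℤ → LatticeLaurent}

/-- A rational specialization kills the exchange polynomial but not the term: `planeWeight` in the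
coordinate that satisfies the bound, the other two cases following by permuting coordinates. -/
theorem exchange_not_dvd_of_le (hp : 0 < p) (hq : 0 < q) (hr : 0 < r)
    (h : CubeRec p q r m T (param 0) (param 1) (param 2) Y)
    (init : ∀ i j k, m ≤ p * i + q * j + r * k → p * i + q * j + r * k < m + (p + q + r) →
      Y i j k = var (i, j, k)) {a b c : ℤ} (hm : p * a + q * b + r * c = m)
    {i j k : ℤ} (h1 : m ≤ p * i + q * j + r * k) (h2 : p * i + q * j + r * k ≤ T)
    (hle : i ≤ a + 1 ∨ j ≤ b + 1 ∨ k ≤ c + 1)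
    (hne : ¬(i = a + 1 ∧ j = b + 1 ∧ k = c + 1)) : ¬ exchange a b c ∣ Y i j k := by
  have key : ∀ φ : LatticeLaurent →+* ℚ, φ (exchange a b c) = 0 → φ (Y i j k) ≠ 0 →
      ¬ exchange a b c ∣ Y i j k := by
    rintro φ h0 h1 ⟨w, hw⟩
    rw [hw, map_mul, h0, zero_mul] at h1
    exact h1 rfl
  rcases hle with hle | hle | hle
  · refine key (lift ![0, 1 / 2, 1 / 2] fun x =>
      Units.mk0 _ (planeWeight_ne_zero a b c x.1 x.2.1 x.2.2)) ?_ ?_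
    · simp [exchange, planeWeight]
    · have := h.map (lift ![0, 1 / 2, 1 / 2] fun x =>
        Units.mk0 _ (planeWeight_ne_zero a b c x.1 x.2.1 x.2.2))
      simp only [lift_param, Matrix.cons_val] at this
      refine planeWeight_term_ne_zero hp hq hr this hm ?_ h1 h2 hle hne
      intro i j k h1 h2
      rw [init i j k h1 h2, lift_var, Units.val_mk0]
  · refine key (lift ![1 / 2, 0, 1 / 2] fun x =>
      Units.mk0 _ (planeWeight_ne_zero b a c x.2.1 x.1 x.2.2)) ?_ ?_
    · simp [exchange, planeWeight]
    · have := h.map (lift ![1 / 2, 0, 1 / 2] fun x =>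
        Units.mk0 _ (planeWeight_ne_zero b a c x.2.1 x.1 x.2.2))
      simp only [lift_param, Matrix.cons_val] at this
      refine planeWeight_term_ne_zero (a := b) (b := a) (c := c) (i := j) (j := i) (k := k) hq hp hr
        this.swap_fst_snd (by linarith) ?_ (by linarith) (by linarith) hle (by tauto)
      intro i j k h1 h2
      rw [init j i k (by linarith) (by linarith), lift_var, Units.val_mk0]
  · refine key (lift ![1 / 2, 1 / 2, 0] fun x =>
      Units.mk0 _ (planeWeight_ne_zero c b a x.2.2 x.2.1 x.1)) ?_ ?_
    · simp [exchange, planeWeight]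
    · have := h.map (lift ![1 / 2, 1 / 2, 0] fun x =>
        Units.mk0 _ (planeWeight_ne_zero c b a x.2.2 x.2.1 x.1))
      simp only [lift_param, Matrix.cons_val] at this
      refine planeWeight_term_ne_zero (a := c) (b := b) (c := a) (i := k) (j := j) (k := i) hr hq hp
        this.swap_fst_trd (by linarith) ?_ (by linarith) (by linarith) hle (by tauto)
      intro i j k h1 h2
      rw [init k j i (by linarith) (by linarith), lift_var, Units.val_mk0]

theorem term_mul_var (h : CubeRec p q r m T (param 0) (param 1) (param 2) Y)
    (hp : 0 < p) (hq : 0 < q) (hr : 0 < r)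
    (init : ∀ i j k, m ≤ p * i + q * j + r * k → p * i + q * j + r * k < m + (p + q + r) →
      Y i j k = var (i, j, k)) {a b c : ℤ} (hm : p * a + q * b + r * c = m)
    (hT : m + (p + q + r) ≤ T) :
    Y (a + 1) (b + 1) (c + 1) * var (a, b, c) = exchange a b c := by
  have := h a b c (by linarith) (by linarith)
  rw [init a b c (by linarith) (by linarith), init a (b + 1) (c + 1) (by linarith) (by linarith),
    init (a + 1) b (c + 1) (by linarith) (by linarith),
    init (a + 1) (b + 1) c (by linarith) (by linarith),
    init (a + 1) b c (by linarith) (by linarith), init a (b + 1) c (by linarith) (by linarith),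
    init a b (c + 1) (by linarith) (by linarith)] at this
  exact this

/-- The homomorphism `solve a b c` followed by a change of sign of the variable at
`(a, b, c)`. -/
noncomputable def solveNeg (a b c : ℤ) : LatticeLaurent →+* LatticeLaurent :=
  lift ![root a b c, param 1, param 2] fun x => if x = (a, b, c) then -var x else var x

theorem solve_var (a b c : ℤ) (x : ℤ × ℤ × ℤ) : solve a b c (var x) = var x := by
  rw [solve, lift_var]

theorem solveNeg_var {a b c i j k : ℤ} (hne : ¬(i = a ∧ j = b ∧ k = c)) :
    solveNeg a b c (var (i, j, k)) = var (i, j, k) := by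
  simp only [solveNeg, lift_var, Prod.mk.injEq, if_neg hne]

theorem solveNeg_var_self (a b c : ℤ) :
    solveNeg a b c (var (a, b, c)) = -var (a, b, c) := by
  simp [solveNeg]

theorem solveNeg_param (a b c : ℤ) (t : Fin 3) :
    solveNeg a b c (param t) = solve a b c (param t) := by
  simp only [solveNeg, solve, lift_param]

theorem solveNeg_eq_zero {a b c : ℤ} {z : LatticeLaurent} (hz : exchange a b c ∣ z) :
    solveNeg a b c z = 0 := by
  have h0 : solveNeg a b c (exchange a b c) = solve a b c (exchange a b c) := by
    simp only [exchange, map_add, map_mul, solve_var, solveNeg_param]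
    rw [solveNeg_var (by omega), solveNeg_var (by omega), solveNeg_var (by omega),
      solveNeg_var (by omega), solveNeg_var (by omega), solveNeg_var (by omega)]
  obtain ⟨w, rfl⟩ := hz
  rw [map_mul, h0, solve_exchange, zero_mul]

/-- Modulo the exchange polynomial these terms do not depend on the variable at `(a, b, c)`. Only
the cube based there divides by it, and the top vertex of that cube is zero modulo the exchange
polynomial. Below level `m + 2 * n` every other cube divides by a variable that both maps fix. -/
theorem solveNeg_eq_solve (hp : 0 < p) (hq : 0 < q) (hr : 0 < r)
    (h : CubeRec p q r m T (param 0) (param 1) (param 2) Y)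
    (init : ∀ i j k, m ≤ p * i + q * j + r * k → p * i + q * j + r * k < m + (p + q + r) →
      Y i j k = var (i, j, k)) {a b c : ℤ} (hm : p * a + q * b + r * c = m)
    (hT : m + 2 * (p + q + r) ≤ T) (i j k : ℤ) (h1 : m < p * i + q * j + r * k)
    (h2 : p * i + q * j + r * k < m + 2 * (p + q + r)) :
    solveNeg a b c (Y i j k) = solve a b c (Y i j k) := by
  refine cube_induction (m := m) (T := m + 2 * (p + q + r) - 1)
    (C := fun i j k => ¬(i = a ∧ j = b ∧ k = c) →
      solveNeg a b c (Y i j k) = solve a b c (Y i j k)) hp hq hr ?_ ?_ i j k h1.le (by linarith)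
      (by rintro ⟨rfl, rfl, rfl⟩; linarith)
  · intro i j k h1 h2 hne
    rw [init i j k h1 h2, solveNeg_var hne, solve_var]
  · intro i j k h1 h2 _ e1 e2 e3 e4 e5 e6 _
    by_cases h0 : i = a ∧ j = b ∧ k = c
    · obtain ⟨rfl, rfl, rfl⟩ := h0
      have hd : exchange i j k ∣ Y (i + 1) (j + 1) (k + 1) := by
        rw [← term_mul_var h hp hq hr init hm (by linarith)]
        exact (Units.mul_right_dvd).mpr dvd_rfl
      rw [solveNeg_eq_zero hd, (exchange_dvd_iff _ _ _ _).mp hd]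
    · have hrec := h i j k h1 (by linarith)
      rw [init i j k h1 (by linarith)] at hrec
      have hx := congrArg (solveNeg a b c) hrec
      have hy := congrArg (solve a b c) hrec
      simp only [map_mul, map_add] at hx hy
      rw [e1 (by rintro ⟨rfl, rfl, rfl⟩; linarith), e2 (by rintro ⟨rfl, rfl, rfl⟩; linarith),
        e3 (by rintro ⟨rfl, rfl, rfl⟩; linarith), e4 (by rintro ⟨rfl, rfl, rfl⟩; linarith),
        e5 (by rintro ⟨rfl, rfl, rfl⟩; linarith), e6 (by rintro ⟨rfl, rfl, rfl⟩; linarith),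
        solveNeg_var h0, solveNeg_param, solveNeg_param, solveNeg_param, ← hy, solve_var] at hx
      exact (var (i, j, k)).isUnit.mul_left_injective hx

/-- In the block identity, changing the sign of the variable at `(a, b, c)` affects, modulo the
exchange polynomial, only the summand containing `Y a b c`, once the left side is assumed to vanish.
Subtracting the two versions makes twice that summand zero, although none of its factors is. -/
theorem exchange_not_dvd_top (hp : 0 < p) (hq : 0 < q) (hr : 0 < r)
    (h : CubeRec p q r m T (param 0) (param 1) (param 2) Y)
    (init : ∀ i j k, m ≤ p * i + q * j + r * k → p * i + q * j + r * k < m + (p + q + r) →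
      Y i j k = var (i, j, k)) {a b c : ℤ} (hm : p * a + q * b + r * c = m)
    (hT : m + 2 * (p + q + r) ≤ T) : ¬ exchange a b c ∣ Y (a + 2) (b + 2) (c + 2) := by
  intro hdvd
  have hne : Y (a + 1) (b + 1) (c + 1) ≠ 0 := by
    intro h0
    have hv := term_mul_var h hp hq hr init hm (by linarith)
    rw [h0, zero_mul] at hv
    exact (prime_exchange a b c).ne_zero hv.symm
  have hblock := h.block hp hq hr a b c hm.ge (by linarith) hne
  have hx := congrArg (solveNeg a b c) hblock
  have hy := congrArg (solve a b c) hblock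
  simp only [map_mul, map_add, map_sub, map_pow] at hx hy
  rw [solveNeg_eq_zero hdvd] at hx
  rw [(exchange_dvd_iff _ _ _ _).mp hdvd] at hy
  have A := solveNeg_eq_solve hp hq hr h init hm hT
  rw [A a (b + 1) (c + 1) (by linarith) (by linarith),
    A (a + 1) b (c + 1) (by linarith) (by linarith),
    A (a + 1) (b + 1) c (by linarith) (by linarith),
    A (a + 2) (b + 1) (c + 1) (by linarith) (by linarith),
    A (a + 1) (b + 2) (c + 1) (by linarith) (by linarith),
    A (a + 1) (b + 1) (c + 2) (by linarith) (by linarith),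
    A a (b + 2) (c + 2) (by linarith) (by linarith),
    A (a + 2) b (c + 2) (by linarith) (by linarith),
    A (a + 2) (b + 2) c (by linarith) (by linarith),
    A (a + 2) b c (by linarith) (by linarith),
    A a (b + 2) c (by linarith) (by linarith),
    A a b (c + 2) (by linarith) (by linarith), solveNeg_param, solveNeg_param, solveNeg_param,
    init a b c (by linarith) (by linarith), solveNeg_var_self] at hx
  rw [init a b c (by linarith) (by linarith), solve_var] at hy
  have ne : ∀ i j k, m ≤ p * i + q * j + r * k → p * i + q * j + r * k ≤ T →
      (i ≤ a + 1 ∨ j ≤ b + 1 ∨ k ≤ c + 1) → ¬(i = a + 1 ∧ j = b + 1 ∧ k = c + 1) →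
      solve a b c (Y i j k) ≠ 0 := fun i j k h1 h2 h3 h4 h0 =>
    exchange_not_dvd_of_le hp hq hr h init hm h1 h2 h3 h4 ((exchange_dvd_iff _ _ _ _).mpr h0)
  have hprod : 2 * (solve a b c (Y (a + 2) (b + 1) (c + 1)) *
      solve a b c (Y (a + 1) (b + 2) (c + 1)) * solve a b c (Y (a + 1) (b + 1) (c + 2))
      * (var (a, b, c) : LatticeLaurent)) = 0 := by
    linear_combination hx - hy
  refine mul_ne_zero two_ne_zero (mul_ne_zero (mul_ne_zero (mul_ne_zero ?_ ?_) ?_)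
    (var (a, b, c)).ne_zero) hprod
  · exact ne _ _ _ (by linarith) (by linarith) (by omega) (by omega)
  · exact ne _ _ _ (by linarith) (by linarith) (by omega) (by omega)
  · exact ne _ _ _ (by linarith) (by linarith) (by omega) (by omega)

/-- The first noninitial term is coprime to all the terms of the next `p + q + r` levels. -/
theorem exchange_not_dvd (hp : 0 < p) (hq : 0 < q) (hr : 0 < r)
    (h : CubeRec p q r m T (param 0) (param 1) (param 2) Y)
    (init : ∀ i j k, m ≤ p * i + q * j + r * k → p * i + q * j + r * k < m + (p + q + r) →
      Y i j k = var (i, j, k)) {a b c : ℤ} (hm : p * a + q * b + r * c = m)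
    (hT : m + 2 * (p + q + r) ≤ T) {i j k : ℤ} (h1 : m + (p + q + r) < p * i + q * j + r * k)
    (h2 : p * i + q * j + r * k ≤ m + 2 * (p + q + r)) : ¬ exchange a b c ∣ Y i j k := by
  by_cases hle : i ≤ a + 1 ∨ j ≤ b + 1 ∨ k ≤ c + 1
  · exact exchange_not_dvd_of_le hp hq hr h init hm (by linarith) (by linarith) hle
      (by rintro ⟨rfl, rfl, rfl⟩; linarith)
  · push Not at hle
    -- All coordinates now exceed those of `(a, b, c)` by at least `2`, so the level bound leaves
    -- only the point `(a + 2, b + 2, c + 2)`.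
    obtain ⟨hi, hj, hk⟩ := hle
    have e1 : 0 ≤ p * (i - (a + 2)) := mul_nonneg hp.le (by omega)
    have e2 : 0 ≤ q * (j - (b + 2)) := mul_nonneg hq.le (by omega)
    have e3 : 0 ≤ r * (k - (c + 2)) := mul_nonneg hr.le (by omega)
    have f1 : p * (i - (a + 2)) = 0 := by linarith
    have f2 : q * (j - (b + 2)) = 0 := by linarith
    have f3 : r * (k - (c + 2)) = 0 := by linarith
    obtain rfl : i = a + 2 := by
      rcases mul_eq_zero.mp f1 with h | h <;> omega
    obtain rfl : j = b + 2 := by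
      rcases mul_eq_zero.mp f2 with h | h <;> omega
    obtain rfl : k = c + 2 := by
      rcases mul_eq_zero.mp f3 with h | h <;> omega
    exact exchange_not_dvd_top hp hq hr h init hm hT

end

end LatticeLaurent

/-! ### The Laurent phenomenon for the cube recurrence -/

/-- The ring of Laurent polynomials in the terms of `Y` at the levels `m, …, m + p + q + r - 1`. -/
def windowRing (p q r m : ℤ) {K : Type*} [Field K] (α β γ : K) (Y : ℤ → ℤ → ℤ → K) :
    Subring K :=
  Subring.closure ({α, β, γ} ∪ {z | ∃ i j k, m ≤ p * i + q * j + r * k ∧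
    p * i + q * j + r * k < m + (p + q + r) ∧ (z = Y i j k ∨ z = (Y i j k)⁻¹)})

section
variable {p q r m : ℤ} {K : Type*} [Field K] {α β γ : K} {Y : ℤ → ℤ → ℤ → K}

theorem fst_mem_windowRing : α ∈ windowRing p q r m α β γ Y :=
  Subring.subset_closure (by simp)

theorem snd_mem_windowRing : β ∈ windowRing p q r m α β γ Y :=
  Subring.subset_closure (by simp)

theorem trd_mem_windowRing : γ ∈ windowRing p q r m α β γ Y :=
  Subring.subset_closure (by simp)

theorem init_mem_windowRing {i j k : ℤ} (h1 : m ≤ p * i + q * j + r * k)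
    (h2 : p * i + q * j + r * k < m + (p + q + r)) : Y i j k ∈ windowRing p q r m α β γ Y :=
  Subring.subset_closure (Or.inr ⟨i, j, k, h1, h2, Or.inl rfl⟩)

theorem init_inv_mem_windowRing {i j k : ℤ} (h1 : m ≤ p * i + q * j + r * k)
    (h2 : p * i + q * j + r * k < m + (p + q + r)) : (Y i j k)⁻¹ ∈ windowRing p q r m α β γ Y :=
  Subring.subset_closure (Or.inr ⟨i, j, k, h1, h2, Or.inr rfl⟩)

theorem windowRing_le {R : Subring K} (hα : α ∈ R) (hβ : β ∈ R) (hγ : γ ∈ R)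
    (h : ∀ i j k, m ≤ p * i + q * j + r * k → p * i + q * j + r * k < m + (p + q + r) →
      Y i j k ∈ R ∧ (Y i j k)⁻¹ ∈ R) : windowRing p q r m α β γ Y ≤ R := by
  rw [windowRing, Subring.closure_le]
  rintro z ((rfl | rfl | rfl) | ⟨i, j, k, h1, h2, rfl | rfl⟩)
  · exact hα
  · exact hβ
  · exact hγ
  · exact (h i j k h1 h2).1
  · exact (h i j k h1 h2).2

end

/-! ### Fractions with prescribed denominators. -/

section
variable {L K : Type*} [CommRing L] [Field K] [Algebra L K]

/-- Elements of a ring generated by fractions with denominators in `D` are such fractions. -/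
theorem exists_mul_mem_range_of_mem_closure (D : Submonoid L) {G : Set K}
    (hG : ∀ g ∈ G, ∃ d ∈ D, algebraMap L K d * g ∈ (algebraMap L K).range) {z : K}
    (hz : z ∈ Subring.closure G) : ∃ d ∈ D, algebraMap L K d * z ∈ (algebraMap L K).range := by
  induction hz using Subring.closure_induction with
  | mem x hx => exact hG x hx
  | zero => exact ⟨1, D.one_mem, by simp [zero_mem]⟩
  | one => exact ⟨1, D.one_mem, by simp [one_mem]⟩
  | add x y _ _ hx hy =>
    obtain ⟨d, hd, hdx⟩ := hx
    obtain ⟨e, he, hey⟩ := hy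
    refine ⟨d * e, D.mul_mem hd he, ?_⟩
    have := add_mem (mul_mem (RingHom.mem_range_self (algebraMap L K) e) hdx)
      (mul_mem (RingHom.mem_range_self (algebraMap L K) d) hey)
    rw [map_mul]
    convert this using 1
    ring
  | neg x _ hx =>
    obtain ⟨d, hd, hdx⟩ := hx
    exact ⟨d, hd, by rw [mul_neg]; exact neg_mem hdx⟩
  | mul x y _ _ hx hy =>
    obtain ⟨d, hd, hdx⟩ := hx
    obtain ⟨e, he, hey⟩ := hy
    refine ⟨d * e, D.mul_mem hd he, ?_⟩
    rw [map_mul, mul_mul_mul_comm]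
    exact mul_mem hdx hey

/-- A fraction with two coprime denominators is integral. -/
theorem mem_range_of_coprime_denominators [FaithfulSMul L K] {P E : Set L}
    (hP : ∀ π ∈ P, Prime π) (hPE : ∀ π ∈ P, ∀ e ∈ E, ¬π ∣ e) {d e : L}
    (hd : d ∈ Submonoid.closure P) (he : e ∈ Submonoid.closure E) {z : K}
    (hdz : algebraMap L K d * z ∈ (algebraMap L K).range)
    (hez : algebraMap L K e * z ∈ (algebraMap L K).range) : z ∈ (algebraMap L K).range := by
  have inj := FaithfulSMul.algebraMap_injective L K
  have hne : ∀ π ∈ P, ¬π ∣ e := by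
    intro π hπ
    clear hez
    induction he using Submonoid.closure_induction with
    | mem x hx => exact hPE π hπ x hx
    | one => exact (hP π hπ).not_dvd_one
    | mul x y _ _ hx hy => exact fun h => ((hP π hπ).dvd_or_dvd h).elim hx hy
  induction hd using Submonoid.closure_induction generalizing z with
  | mem π hπ =>
    obtain ⟨s, hs⟩ := hdz
    obtain ⟨t, ht⟩ := hez
    -- Both sides are the image of `π * e * z`; as the prime `π` does not divide `e`, it divides
    -- `s`.
    have h : e * s = π * t := inj (by rw [map_mul, map_mul, hs, ht]; ring)
    obtain ⟨u, rfl⟩ := ((hP π hπ).dvd_or_dvd (Dvd.intro t h.symm)).resolve_left (hne π hπ)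
    refine ⟨u, ?_⟩
    have h0 : algebraMap L K π ≠ 0 := by
      rw [Ne, inj.eq_iff' (map_zero _)]
      exact (hP π hπ).ne_zero
    rw [map_mul] at hs
    exact mul_left_cancel₀ h0 hs
  | one => simpa using hdz
  | mul x y _ _ hx hy =>
    refine hy (hx ?_ ?_) hez
    · rwa [map_mul, mul_assoc] at hdz
    · rw [mul_left_comm]
      exact mul_mem (RingHom.mem_range_self _ _) hez

end

/-! ### Window comparison and specialization of the generic solution. -/

namespace LatticeLaurent

section
variable {p q r m T : ℤ} {K : Type*} [Field K] [Algebra LatticeLaurent K]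
  {G : ℤ → ℤ → ℤ → K}

theorem windowRing_le_range
    (init : ∀ i j k, p * i + q * j + r * k < m + (p + q + r) →
      G i j k = algebraMap LatticeLaurent K (var (i, j, k))) :
    windowRing p q r m (algebraMap LatticeLaurent K (param 0))
      (algebraMap LatticeLaurent K (param 1)) (algebraMap LatticeLaurent K (param 2)) G ≤
      (algebraMap LatticeLaurent K).range := by
  refine windowRing_le ⟨_, rfl⟩ ⟨_, rfl⟩ ⟨_, rfl⟩ fun i j k _ h2 => ?_
  rw [init i j k h2]
  refine ⟨⟨_, rfl⟩, ⟨((var (i, j, k))⁻¹ : LatticeLaurentˣ), ?_⟩⟩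
  exact eq_inv_of_mul_eq_one_left (by rw [← map_mul, Units.inv_mul, map_one])

/-- A solution of the recurrence with values in the image of the Laurent ring lifts to it. -/
theorem exists_lift_cubeRec [FaithfulSMul LatticeLaurent K]
    (hp : 0 < p) (hq : 0 < q) (hr : 0 < r)
    (init : ∀ i j k, p * i + q * j + r * k < m + (p + q + r) →
      G i j k = algebraMap LatticeLaurent K (var (i, j, k)))
    (h : CubeRec p q r m T (algebraMap LatticeLaurent K (param 0))
      (algebraMap LatticeLaurent K (param 1)) (algebraMap LatticeLaurent K (param 2)) G)
    (range : ∀ i j k, m ≤ p * i + q * j + r * k → p * i + q * j + r * k ≤ T →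
      G i j k ∈ (algebraMap LatticeLaurent K).range) :
    ∃ Y : ℤ → ℤ → ℤ → LatticeLaurent,
      (∀ i j k, m ≤ p * i + q * j + r * k → p * i + q * j + r * k ≤ T →
        algebraMap LatticeLaurent K (Y i j k) = G i j k) ∧
      CubeRec p q r m T (param 0) (param 1) (param 2) Y ∧
      (m + (p + q + r) ≤ T → ∀ i j k, m ≤ p * i + q * j + r * k →
        p * i + q * j + r * k < m + (p + q + r) → Y i j k = var (i, j, k)) := by
  have inj := FaithfulSMul.algebraMap_injective LatticeLaurent K
  have : ∀ i j k, ∃ y : LatticeLaurent, m ≤ p * i + q * j + r * k →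
      p * i + q * j + r * k ≤ T → algebraMap LatticeLaurent K y = G i j k := by
    intro i j k
    by_cases hlev : m ≤ p * i + q * j + r * k ∧ p * i + q * j + r * k ≤ T
    · obtain ⟨y, hy⟩ := range i j k hlev.1 hlev.2
      exact ⟨y, fun _ _ => hy⟩
    · exact ⟨0, fun h1 h2 => absurd ⟨h1, h2⟩ hlev⟩
  choose Y hY using this
  refine ⟨Y, hY, ?_, ?_⟩
  · intro i j k h1 h2
    apply inj
    simp only [map_mul, map_add]
    have := h i j k h1 h2
    rwa [← hY _ _ _ (by linarith) (by linarith), ← hY _ _ _ (by linarith) (by linarith),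
      ← hY i (j + 1) (k + 1) (by linarith) (by linarith),
      ← hY (i + 1) j (k + 1) (by linarith) (by linarith),
      ← hY (i + 1) (j + 1) k (by linarith) (by linarith),
      ← hY (i + 1) j k (by linarith) (by linarith), ← hY i (j + 1) k (by linarith) (by linarith),
      ← hY i j (k + 1) (by linarith) (by linarith)] at this
  · intro hT i j k h1 h2
    exact inj (by rw [hY i j k h1 (by linarith), init i j k h2])

/-- Comparing two windows shows that a term of the generic solution is a Laurent polynomial. -/
theorem mem_range_of_mem_windowRing [FaithfulSMul LatticeLaurent K]
    (hp : 0 < p) (hq : 0 < q) (hr : 0 < r) (h0 : ∀ i j k, G i j k ≠ 0)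
    (init : ∀ i j k, p * i + q * j + r * k < m + (p + q + r) →
      G i j k = algebraMap LatticeLaurent K (var (i, j, k)))
    (h : CubeRec p q r m T (algebraMap LatticeLaurent K (param 0))
      (algebraMap LatticeLaurent K (param 1)) (algebraMap LatticeLaurent K (param 2)) G)
    (hT : m + 2 * (p + q + r) ≤ T)
    (range : ∀ i j k, m ≤ p * i + q * j + r * k → p * i + q * j + r * k ≤ T →
      G i j k ∈ (algebraMap LatticeLaurent K).range) {z : K}
    (hz : z ∈ windowRing p q r (m + 1) (algebraMap LatticeLaurent K (param 0))
      (algebraMap LatticeLaurent K (param 1)) (algebraMap LatticeLaurent K (param 2)) G)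
    (hz' : z ∈ windowRing p q r (m + (p + q + r) + 1) (algebraMap LatticeLaurent K (param 0))
      (algebraMap LatticeLaurent K (param 1)) (algebraMap LatticeLaurent K (param 2)) G) :
    z ∈ (algebraMap LatticeLaurent K).range := by
  obtain ⟨Y, hYG, hY, hYinit⟩ := exists_lift_cubeRec hp hq hr init h range
  specialize hYinit (by linarith)
  let P : Set LatticeLaurent :=
    {x | ∃ a b c, p * a + q * b + r * c = m ∧ x = exchange a b c}
  let E : Set LatticeLaurent :=
    {x | ∃ i j k, m + (p + q + r) < p * i + q * j + r * k ∧
      p * i + q * j + r * k ≤ m + 2 * (p + q + r) ∧ x = Y i j k}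
  obtain ⟨d, hd, hdz⟩ : ∃ d ∈ Submonoid.closure P,
      algebraMap LatticeLaurent K d * z ∈ (algebraMap LatticeLaurent K).range := by
    refine exists_mul_mem_range_of_mem_closure _ ?_ hz
    rintro z ((rfl | rfl | rfl) | ⟨i, j, k, h1, h2, rfl | rfl⟩)
    · exact ⟨1, one_mem _, by simp⟩
    · exact ⟨1, one_mem _, by simp⟩
    · exact ⟨1, one_mem _, by simp⟩
    · exact ⟨1, one_mem _, by
        rw [map_one, one_mul]; exact range i j k (by linarith) (by linarith)⟩
    · by_cases hlt : p * i + q * j + r * k < m + (p + q + r)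
      · refine ⟨1, one_mem _, ?_⟩
        rw [map_one, one_mul]
        exact windowRing_le_range init (init_inv_mem_windowRing (by linarith) hlt)
      -- Only the top level `m + n` of this window lies outside the initial one. Its terms are
      -- exchange polynomials divided by a variable.
      · have hm : p * (i - 1) + q * (j - 1) + r * (k - 1) = m := by linarith
        have hv := term_mul_var hY hp hq hr hYinit hm (by linarith)
        simp only [sub_add_cancel] at hv
        refine ⟨exchange (i - 1) (j - 1) (k - 1), Submonoid.subset_closure
          ⟨i - 1, j - 1, k - 1, hm, rfl⟩, var (i - 1, j - 1, k - 1), ?_⟩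
        rw [← hv, map_mul, hYG i j k (by linarith) (by linarith), mul_right_comm,
          mul_inv_cancel₀ (h0 i j k), one_mul]
  obtain ⟨e, he, hez⟩ : ∃ e ∈ Submonoid.closure E,
      algebraMap LatticeLaurent K e * z ∈ (algebraMap LatticeLaurent K).range := by
    refine exists_mul_mem_range_of_mem_closure _ ?_ hz'
    rintro z ((rfl | rfl | rfl) | ⟨i, j, k, h1, h2, rfl | rfl⟩)
    · exact ⟨1, one_mem _, by simp⟩
    · exact ⟨1, one_mem _, by simp⟩
    · exact ⟨1, one_mem _, by simp⟩
    · refine ⟨1, one_mem _, ?_⟩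
      rw [map_one, one_mul]
      exact range i j k (by linarith) (by linarith)
    · refine ⟨Y i j k, Submonoid.subset_closure
        ⟨i, j, k, by linarith, by linarith, rfl⟩, ?_⟩
      rw [hYG i j k (by linarith) (by linarith), mul_inv_cancel₀ (h0 i j k)]
      exact one_mem _
  refine mem_range_of_coprime_denominators ?_ ?_ hd he hdz hez
  · rintro _ ⟨a, b, c, _, rfl⟩
    exact prime_exchange a b c
  · rintro _ ⟨a, b, c, hm, rfl⟩ _ ⟨i, j, k, h1, h2, rfl⟩
    exact exchange_not_dvd hp hq hr hY hYinit hm hT h1 h2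

/-- Laurent polynomial formulas for the generic solution specialize to any solution. -/
theorem mem_windowRing_of_generic [FaithfulSMul LatticeLaurent K]
    (hp : 0 < p) (hq : 0 < q) (hr : 0 < r)
    (init : ∀ i j k, p * i + q * j + r * k < m + (p + q + r) →
      G i j k = algebraMap LatticeLaurent K (var (i, j, k)))
    (h : CubeRec p q r m T (algebraMap LatticeLaurent K (param 0))
      (algebraMap LatticeLaurent K (param 1)) (algebraMap LatticeLaurent K (param 2)) G)
    (hT : m + (p + q + r) ≤ T)
    (range : ∀ i j k, m ≤ p * i + q * j + r * k → p * i + q * j + r * k ≤ T →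
      G i j k ∈ (algebraMap LatticeLaurent K).range)
    {F : Type*} [Field F] {α β γ : F} {Z : ℤ → ℤ → ℤ → F} (hZ0 : ∀ i j k, Z i j k ≠ 0)
    (hZ : CubeRec p q r m T α β γ Z) {i j k : ℤ} (h1 : m ≤ p * i + q * j + r * k)
    (h2 : p * i + q * j + r * k ≤ T) : Z i j k ∈ windowRing p q r m α β γ Z := by
  obtain ⟨Y, -, hY, hYinit⟩ := exists_lift_cubeRec hp hq hr init h range
  specialize hYinit hT
  classical
  -- Variables outside the window do not matter; the value `1` keeps the image inside the window
  -- ring.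
  let f : ℤ × ℤ × ℤ → Fˣ := fun x =>
    if m ≤ p * x.1 + q * x.2.1 + r * x.2.2 ∧ p * x.1 + q * x.2.1 + r * x.2.2 < m + (p + q + r) then
      Units.mk0 _ (hZ0 x.1 x.2.1 x.2.2) else 1
  have hYZ := hY.map (lift ![α, β, γ] f)
  simp only [lift_param, Matrix.cons_val] at hYZ
  have e : lift ![α, β, γ] f (Y i j k) = Z i j k := by
    refine CubeRec.ext hp hq hr hZ hYZ hZ0 ?_ i j k h1 h2
    intro i j k h1 h2
    rw [hYinit i j k h1 h2, lift_var]
    simp only [f, if_pos (And.intro h1 h2), Units.val_mk0]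
  rw [← e]
  apply lift_mem
  · intro t
    fin_cases t
    · exact fst_mem_windowRing
    · exact snd_mem_windowRing
    · exact trd_mem_windowRing
  · intro x
    by_cases hx : m ≤ p * x.1 + q * x.2.1 + r * x.2.2 ∧
        p * x.1 + q * x.2.1 + r * x.2.2 < m + (p + q + r)
    · simp only [f, if_pos hx, Units.val_mk0]
      exact init_mem_windowRing hx.1 hx.2
    · simp only [f, if_neg hx, Units.val_one, one_mem]
  · intro x
    by_cases hx : m ≤ p * x.1 + q * x.2.1 + r * x.2.2 ∧
        p * x.1 + q * x.2.1 + r * x.2.2 < m + (p + q + r)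
    · simp only [f, if_pos hx, Units.val_mk0]
      exact init_inv_mem_windowRing hx.1 hx.2
    · simp only [f, if_neg hx, Units.val_one, inv_one, one_mem]

end

/-- The generic solution of the cube recurrence with free values at the levels below
`m + (p + q + r)`. -/
noncomputable def generic {p q r : ℤ} (m : ℤ) (hp : 0 < p) (hq : 0 < q) (hr : 0 < r) :
    ℤ → ℤ → ℤ → FractionRing LatticeLaurent :=
  cubeSol m hp hq hr (algebraMap LatticeLaurent _ (param 0)) (algebraMap LatticeLaurent _ (param 1))
    (algebraMap LatticeLaurent _ (param 2))
    fun i j k => algebraMap LatticeLaurent _ (var (i, j, k))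

theorem generic_ne_zero {p q r : ℤ} (m : ℤ) (hp : 0 < p) (hq : 0 < q) (hr : 0 < r) (i j k : ℤ) :
    generic m hp hq hr i j k ≠ 0 := by
  refine IsPosFrac.ne_zero (ε := one) (cubeSol_mem m hp hq hr _ _ _ _ (C := IsPosFrac one)
    (fun _ _ => .add) (fun _ _ => .mul) (fun _ _ => .div) (.of_pos ?_) (.of_pos ?_) (.of_pos ?_)
    (fun i j k => .of_pos ?_) i j k) <;> simp [one]

end LatticeLaurent

open LatticeLaurent in
/-- The Laurent phenomenon for the cube recurrence. -/
theorem CubeRec.mem_windowRing {p q r m T : ℤ} (hp : 0 < p) (hq : 0 < q) (hr : 0 < r)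
    {K : Type} [Field K] {α β γ : K} {Y : ℤ → ℤ → ℤ → K} (h0 : ∀ i j k, Y i j k ≠ 0)
    (h : CubeRec p q r m T α β γ Y) {i j k : ℤ} (h1 : m ≤ p * i + q * j + r * k)
    (h2 : p * i + q * j + r * k ≤ T) : Y i j k ∈ windowRing p q r m α β γ Y := by
  -- The field varies in the induction because the last case applies the hypothesis to the generic
  -- solution.
  induction hN : (T - m).toNat using Nat.strong_induction_on generalizing m T K α β γ i j k with
  | _ N ih =>
  by_cases hwin : p * i + q * j + r * k < m + (p + q + r)
  · exact init_mem_windowRing h1 hwin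
  have low : ∀ i j k, m ≤ p * i + q * j + r * k → p * i + q * j + r * k < T →
      Y i j k ∈ windowRing p q r m α β γ Y := fun i j k h1 h2 =>
    ih _ (by omega) h0 (h.mono le_rfl (sub_le_self T zero_le_one)) h1 (by linarith) rfl
  by_cases hlt : p * i + q * j + r * k < T
  · exact low i j k h1 hlt
  rcases lt_trichotomy T (m + 2 * (p + q + r)) with hT | hT | hT
  · have hrec := h (i - 1) (j - 1) (k - 1) (by linarith) (by linarith)
    simp only [sub_add_cancel] at hrec
    rw [(eq_mul_inv_iff_mul_eq₀ (h0 _ _ _)).mpr hrec]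
    refine mul_mem (add_mem (add_mem (mul_mem (mul_mem fst_mem_windowRing ?_) ?_)
      (mul_mem (mul_mem snd_mem_windowRing ?_) ?_)) (mul_mem (mul_mem trd_mem_windowRing ?_) ?_))
      (init_inv_mem_windowRing (by linarith) (by linarith)) <;>
    exact low _ _ _ (by linarith) (by linarith)
  · have hb := h.block hp hq hr (i - 2) (j - 2) (k - 2) (by linarith) (by linarith) (h0 _ _ _)
    have e : ∀ x : ℤ, x - 2 + 1 = x - 1 := fun x => by ring
    simp only [sub_add_cancel, e] at hb
    rw [mul_comm] at hb
    rw [(eq_mul_inv_iff_mul_eq₀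
      (mul_ne_zero (mul_ne_zero (h0 _ _ _) (h0 _ _ _)) (h0 _ _ _))).mpr hb,
      mul_inv, mul_inv]
    have w : ∀ a b c, m ≤ p * a + q * b + r * c → p * a + q * b + r * c < m + (p + q + r) →
      (Y a b c)⁻¹ ∈ windowRing p q r m α β γ Y := fun _ _ _ => init_inv_mem_windowRing
    refine mul_mem ?_ (mul_mem (mul_mem (w _ _ _ (by linarith) (by linarith))
      (w _ _ _ (by linarith) (by linarith))) (w _ _ _ (by linarith) (by linarith)))
    have t1 := low (i - 2) (j - 1) (k - 1) (by linarith) (by linarith)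
    have t2 := low (i - 1) (j - 2) (k - 1) (by linarith) (by linarith)
    have t3 := low (i - 1) (j - 1) (k - 2) (by linarith) (by linarith)
    have t4 := low i (j - 1) (k - 1) (by linarith) (by linarith)
    have t5 := low (i - 1) j (k - 1) (by linarith) (by linarith)
    have t6 := low (i - 1) (j - 1) k (by linarith) (by linarith)
    have t7 := low (i - 2) j k (by linarith) (by linarith)
    have t8 := low i (j - 2) k (by linarith) (by linarith)
    have t9 := low i j (k - 2) (by linarith) (by linarith)
    have s7 := low i (j - 2) (k - 2) (by linarith) (by linarith)
    have s8 := low (i - 2) j (k - 2) (by linarith) (by linarith)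
    have s9 := low (i - 2) (j - 2) k (by linarith) (by linarith)
    have s0 := low (i - 2) (j - 2) (k - 2) (by linarith) (by linarith)
    have ha : α ∈ windowRing p q r m α β γ Y := fst_mem_windowRing
    have hb : β ∈ windowRing p q r m α β γ Y := snd_mem_windowRing
    have hc : γ ∈ windowRing p q r m α β γ Y := trd_mem_windowRing
    repeat' first | assumption | apply add_mem | apply sub_mem | apply mul_mem | apply pow_mem
  · have gne := generic_ne_zero m hp hq hr
    have grec : CubeRec p q r m T _ _ _ (generic m hp hq hr) :=
      cubeSol_cubeRec m hp hq hr _ _ _ _ gne T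
    have ginit : ∀ i j k, p * i + q * j + r * k < m + (p + q + r) → generic m hp hq hr i j k =
        algebraMap LatticeLaurent (FractionRing LatticeLaurent) (var (i, j, k)) :=
      fun i j k h => cubeSol_init m hp hq hr _ _ _ _ i j k h
    have glow : ∀ i j k, m ≤ p * i + q * j + r * k → p * i + q * j + r * k ≤ T - 1 →
        generic m hp hq hr i j k ∈
          (algebraMap LatticeLaurent (FractionRing LatticeLaurent)).range := fun i j k h1 h2 =>
      windowRing_le_range ginit
        (ih _ (by omega) gne (grec.mono le_rfl (sub_le_self T zero_le_one)) h1 h2 rfl)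
    refine mem_windowRing_of_generic hp hq hr ginit grec (by linarith) ?_ h0 h h1 h2
    intro i j k h1 h2
    by_cases hlt : p * i + q * j + r * k ≤ T - 1
    · exact glow i j k h1 hlt
    refine mem_range_of_mem_windowRing hp hq hr gne ginit
      (grec.mono le_rfl (sub_le_self T zero_le_one)) (by linarith) glow ?_ ?_
    · exact ih _ (by omega) gne (grec.mono (by linarith) le_rfl) (by linarith) h2 rfl
    · exact ih _ (by omega) gne (grec.mono (by linarith) le_rfl) (by linarith) h2 rfl

/-! ### Gale-Robinson sequences -/

section
variable {p q r : ℕ}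

/-- Induction along the Gale-Robinson recurrence. -/
theorem galeRobinson_induction (hp : 0 < p) (hq : 0 < q) (hr : 0 < r) {C : ℕ → Prop}
    (init : ∀ k < p + q + r, C k)
    (step : ∀ k, C k → C (k + p) → C (k + (p + q + r) - p) → C (k + q) →
      C (k + (p + q + r) - q) → C (k + r) → C (k + (p + q + r) - r) → C (k + (p + q + r)))
    (k : ℕ) : C k := by
  induction k using Nat.strong_induction_on with
  | _ k ih =>
    rcases lt_or_ge k (p + q + r) with h | h
    · exact init k h
    · obtain ⟨k, rfl⟩ := Nat.exists_eq_add_of_le' h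
      apply step <;> apply ih <;> omega

/-- The Gale-Robinson sequence with initial values `f`. -/
noncomputable def galeRobinson (hp : 0 < p) (hq : 0 < q) (hr : 0 < r) {F : Type*} [Field F]
    (α β γ : F) (f : ℕ → F) (k : ℕ) : F :=
  if k < p + q + r then f k else
    (α * galeRobinson hp hq hr α β γ f (k - (p + q + r) + p)
        * galeRobinson hp hq hr α β γ f (k - p)
      + β * galeRobinson hp hq hr α β γ f (k - (p + q + r) + q)
        * galeRobinson hp hq hr α β γ f (k - q)
      + γ * galeRobinson hp hq hr α β γ f (k - (p + q + r) + r)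
        * galeRobinson hp hq hr α β γ f (k - r))
      / galeRobinson hp hq hr α β γ f (k - (p + q + r))
termination_by k

theorem galeRobinson_isGaleRobinson (hp : 0 < p) (hq : 0 < q) (hr : 0 < r) {F : Type*} [Field F]
    (α β γ : F) (f : ℕ → F) : IsGaleRobinson p q r α β γ (galeRobinson hp hq hr α β γ f) := by
  intro k
  rw [galeRobinson, if_neg (by omega)]
  simp only [add_tsub_cancel_right]

theorem galeRobinson_init (hp : 0 < p) (hq : 0 < q) (hr : 0 < r) {F : Type*} [Field F]
    (α β γ : F) (f : ℕ → F) {k : ℕ} (hk : k < p + q + r) :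
    galeRobinson hp hq hr α β γ f k = f k := by
  rw [galeRobinson, if_pos hk]

variable {F : Type*} [Field F] {α β γ : F} {y : ℕ → F}

theorem IsGaleRobinson.ext (hp : 0 < p) (hq : 0 < q) (hr : 0 < r) {z : ℕ → F}
    (hy : IsGaleRobinson p q r α β γ y) (hz : IsGaleRobinson p q r α β γ z)
    (init : ∀ k < p + q + r, y k = z k) : y = z := by
  funext k
  refine galeRobinson_induction (C := fun k => y k = z k) hp hq hr init ?_ k
  intro k h0 h1 h2 h3 h4 h5 h6
  rw [hy, hz, h0, h1, h2, h3, h4, h5, h6]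

theorem IsGaleRobinson.forall_mem (hp : 0 < p) (hq : 0 < q) (hr : 0 < r)
    (hy : IsGaleRobinson p q r α β γ y) {C : F → Prop}
    (hadd : ∀ x y, C x → C y → C (x + y)) (hmul : ∀ x y, C x → C y → C (x * y))
    (hdiv : ∀ x y, C x → C y → C (x / y)) (hα : C α) (hβ : C β) (hγ : C γ)
    (init : ∀ k < p + q + r, C (y k)) (k : ℕ) : C (y k) := by
  refine galeRobinson_induction (C := fun k => C (y k)) hp hq hr init ?_ k
  intro k h0 h1 h2 h3 h4 h5 h6
  rw [hy]
  exact hdiv _ _ (hadd _ _ (hadd _ _ (hmul _ _ (hmul _ _ hα h1) h2)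
    (hmul _ _ (hmul _ _ hβ h3) h4)) (hmul _ _ (hmul _ _ hγ h5) h6)) h0

end

/-- The Laurent phenomenon for Gale-Robinson sequences: every term lies in any ring containing the
coefficients, the initial terms and their inverses. -/
theorem IsGaleRobinson.mem_subring {p q r : ℕ} (hp : 0 < p) (hq : 0 < q) (hr : 0 < r)
    {F : Type} [Field F] {α β γ : F} {y : ℕ → F} (hy : IsGaleRobinson p q r α β γ y)
    (h0 : ∀ k, y k ≠ 0) {R : Subring F} (hα : α ∈ R) (hβ : β ∈ R) (hγ : γ ∈ R)
    (init : ∀ k < p + q + r, y k ∈ R ∧ (y k)⁻¹ ∈ R) (M : ℕ) : y M ∈ R := by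
  -- The term `y M` sits at the origin and the initial terms at levels `-M` to `-M + n - 1`. Lower
  -- levels get the harmless nonzero value `y 0`.
  let Y : ℤ → ℤ → ℤ → F := fun i j k => y (M + (p * i + q * j + r * k)).toNat
  have hY : ∀ (i j k : ℤ) (t : ℕ), M + (p * i + q * j + r * k) = (t : ℤ) → Y i j k = y t :=
    fun i j k t ht => by simp only [Y, ht, Int.toNat_natCast]
  have hrec : CubeRec p q r (-M) 0 α β γ Y := by
    intro i j k h1 _
    obtain ⟨s, hs⟩ := Int.eq_ofNat_of_zero_le (a := M + (p * i + q * j + r * k)) (by linarith)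
    rw [hY i j k s hs, hY (i + 1) (j + 1) (k + 1) (s + (p + q + r)) (by push_cast; linarith),
      hY i (j + 1) (k + 1) (s + (q + r)) (by push_cast; linarith),
      hY (i + 1) j (k + 1) (s + (p + r)) (by push_cast; linarith),
      hY (i + 1) (j + 1) k (s + (p + q)) (by push_cast; linarith),
      hY (i + 1) j k (s + p) (by push_cast; linarith),
      hY i (j + 1) k (s + q) (by push_cast; linarith),
      hY i j (k + 1) (s + r) (by push_cast; linarith), hy, div_mul_cancel₀ _ (h0 s),
      show s + (p + q + r) - p = s + (q + r) by omega,
      show s + (p + q + r) - q = s + (p + r) by omega,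
      show s + (p + q + r) - r = s + (p + q) by omega]
    ring
  have hmem : Y 0 0 0 ∈ windowRing p q r (-M) α β γ Y :=
    hrec.mem_windowRing (by exact_mod_cast hp) (by exact_mod_cast hq) (by exact_mod_cast hr)
      (fun i j k => h0 _) (by simp) (by simp)
  rw [hY 0 0 0 M (by simp)] at hmem
  refine windowRing_le hα hβ hγ (fun i j k h1 h2 => ?_) hmem
  obtain ⟨s, hs⟩ := Int.eq_ofNat_of_zero_le (a := M + (p * i + q * j + r * k)) (by linarith)
  rw [hY i j k s hs]
  refine init s ?_
  zify
  rw [← hs]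
  linarith

theorem IsGenericGaleRobinson.existsUnique {p q r : ℕ} (hp : 0 < p) (hq : 0 < q) (hr : 0 < r) :
    ∃! y : ℕ → GRField (p + q + r), IsGenericGaleRobinson p q r y := by
  refine ⟨galeRobinson hp hq hr (GRField.param _ 0) (GRField.param _ 1) (GRField.param _ 2)
    fun k => if h : k < p + q + r then GRField.var _ ⟨k, h⟩ else 0,
    ⟨fun i => ?_, galeRobinson_isGaleRobinson _ _ _ _ _ _ _⟩, fun z hz => ?_⟩
  · rw [galeRobinson_init _ _ _ _ _ _ _ i.2, dif_pos i.2]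
  · refine hz.2.ext hp hq hr (galeRobinson_isGaleRobinson _ _ _ _ _ _ _) fun k hk => ?_
    rw [galeRobinson_init _ _ _ _ _ _ _ hk, dif_pos hk]
    exact hz.1 ⟨k, hk⟩

theorem IsGenericGaleRobinson.ne_zero {p q r : ℕ} (hp : 0 < p) (hq : 0 < q) (hr : 0 < r)
    {y : ℕ → GRField (p + q + r)} (hy : IsGenericGaleRobinson p q r y) (k : ℕ) : y k ≠ 0 := by
  let ε : MvPolynomial (Fin (p + q + r)) GRCoeff →+* ℚ :=
    MvPolynomial.eval₂Hom (MvPolynomial.eval₂Hom (Int.castRingHom ℚ) fun _ => 1) fun _ => 1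
  have hparam : ∀ t, IsPosFrac ε (GRField.param (p + q + r) t) := by
    intro t
    rw [GRField.param, IsScalarTower.algebraMap_apply GRCoeff
      (MvPolynomial (Fin (p + q + r)) GRCoeff) (GRField (p + q + r))]
    refine .of_pos ?_
    simp [ε, MvPolynomial.algebraMap_eq]
  refine IsPosFrac.ne_zero (hy.2.forall_mem hp hq hr (C := IsPosFrac ε) (fun _ _ => .add)
    (fun _ _ => .mul) (fun _ _ => .div) (hparam 0) (hparam 1) (hparam 2) ?_ k)
  intro k hk
  rw [hy.1 ⟨k, hk⟩]
  refine .of_pos ?_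
  simp [ε]

theorem IsGenericGaleRobinson.mem_laurentRing {p q r : ℕ} (hp : 0 < p) (hq : 0 < q) (hr : 0 < r)
    {y : ℕ → GRField (p + q + r)} (hy : IsGenericGaleRobinson p q r y) (k : ℕ) :
    y k ∈ laurentRing (p + q + r) := by
  have hparam : ∀ t, GRField.param (p + q + r) t ∈ (laurentRing (p + q + r)).toSubring :=
    fun t => (laurentRing (p + q + r)).algebraMap_mem _
  refine hy.2.mem_subring hp hq hr (hy.ne_zero hp hq hr)
    (R := (laurentRing (p + q + r)).toSubring) (hparam 0) (hparam 1) (hparam 2) ?_ k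
  intro k hk
  rw [hy.1 ⟨k, hk⟩]
  exact ⟨Algebra.subset_adjoin (Or.inl ⟨_, rfl⟩), Algebra.subset_adjoin (Or.inr ⟨_, rfl⟩)⟩

/-- The Gale-Robinson integrality conjecture. -/
theorem IsGaleRobinson.integral {p q r : ℕ} (hp : 0 < p) (hq : 0 < q) (hr : 0 < r) {a b c : ℤ}
    (ha : 0 < a) (hb : 0 < b) (hc : 0 < c) {y : ℕ → ℚ} (init : ∀ i < p + q + r, y i = 1)
    (hy : IsGaleRobinson p q r (a : ℚ) (b : ℚ) (c : ℚ) y) (m : ℕ) :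
    y m ≠ 0 ∧ ∃ z : ℤ, y m = (z : ℚ) := by
  have hpos : ∀ k, 0 < y k := hy.forall_mem hp hq hr (C := fun x => 0 < x)
    (fun _ _ => add_pos) (fun _ _ => mul_pos) (fun _ _ => div_pos) (by exact_mod_cast ha)
    (by exact_mod_cast hb) (by exact_mod_cast hc) fun k hk => by rw [init k hk]; exact one_pos
  refine ⟨(hpos m).ne', ?_⟩
  -- The initial value `1` is a unit of `ℤ`, so the Laurent phenomenon applies with `ℤ` as the
  -- subring.
  obtain ⟨z, hz⟩ := hy.mem_subring hp hq hr (fun k => (hpos k).ne')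
    (R := (Int.castRingHom ℚ).range) ⟨a, rfl⟩ ⟨b, rfl⟩ ⟨c, rfl⟩
    (fun k hk => by rw [init k hk, inv_one]; exact ⟨one_mem _, one_mem _⟩) m
  exact ⟨z, hz.symm⟩

theorem theorem1p2 :
    (∀ p q r : ℕ, 0 < p → 0 < q → 0 < r → p ≠ q → p ≠ r → q ≠ r →
      -- The generic sequence is well defined, never divides by zero, and is Laurent.
      (∃! y : ℕ → GRField (p + q + r), IsGenericGaleRobinson p q r y) ∧
      (∀ y : ℕ → GRField (p + q + r), IsGenericGaleRobinson p q r y →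
        ∀ m : ℕ, y m ≠ 0 ∧ y m ∈ laurentRing (p + q + r)) ∧
      -- The integrality conjecture.
      (∀ (a b c : ℤ), 0 < a → 0 < b → 0 < c → ∀ y : ℕ → ℚ,
        (∀ i < p + q + r, y i = 1) → IsGaleRobinson p q r (a : ℚ) (b : ℚ) (c : ℚ) y →
        ∀ m : ℕ, y m ≠ 0 ∧ ∃ z : ℤ, y m = (z : ℚ))) ∧
    -- Somos-6.
    (∀ y : ℕ → ℚ, (∀ i < 6, y i = 1) →
      (∀ k : ℕ, y (k + 6) =
        (y (k + 1) * y (k + 5) + y (k + 2) * y (k + 4) + y (k + 3) ^ 2) / y k) →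
      ∀ m : ℕ, y m ≠ 0 ∧ ∃ z : ℤ, y m = (z : ℚ)) ∧
    -- Somos-7.
    (∀ y : ℕ → ℚ, (∀ i < 7, y i = 1) →
      (∀ k : ℕ, y (k + 7) =
        (y (k + 1) * y (k + 6) + y (k + 2) * y (k + 5) + y (k + 3) * y (k + 4)) / y k) →
      ∀ m : ℕ, y m ≠ 0 ∧ ∃ z : ℤ, y m = (z : ℚ)) := by
  refine ⟨fun p q r hp hq hr _ _ _ => ⟨IsGenericGaleRobinson.existsUnique hp hq hr,
    fun y hy m => ⟨hy.ne_zero hp hq hr m, hy.mem_laurentRing hp hq hr m⟩,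
    fun a b c ha hb hc y init hy m => hy.integral hp hq hr ha hb hc init m⟩,
    fun y init hy m => ?_, fun y init hy m => ?_⟩
  · refine IsGaleRobinson.integral (p := 1) (q := 2) (r := 3) (a := 1) (b := 1) (c := 1)
      one_pos two_pos three_pos one_pos one_pos one_pos init (fun k => ?_) m
    have e : k + 6 - 3 = k + 3 := rfl
    simpa [e, sq] using hy k
  -- Here `7 = 1 + 2 + 4`, and the pair for `r = 4` is `y (k + 4) * y (k + 3)`.
  · refine IsGaleRobinson.integral (p := 1) (q := 2) (r := 4) (a := 1) (b := 1) (c := 1)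
      one_pos two_pos four_pos one_pos one_pos one_pos init (fun k => ?_) m
    have e : k + 7 - 4 = k + 3 := rfl
    have h := hy k
    rw [mul_comm (y (k + 3))] at h
    simpa [e] using h
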